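/- **Proposition (Uniform high-probability lower bound for $\Gamma$).** For integers $0\le d\le n$, let $P\in\mathbb R^{d\times n}$ be a Haar-distributed random element of the Stiefel manifold $\{P\in\mathbb R^{d\times n}: PP^\top=I_d\}$ (that is, $P$ has the law of the first $d$ rows of a Haar-distributed orthogonal $n\times n$ matrix). For $u,v\in S^{n-1}$ with $\langle u,v\rangle<1$ put $$ \Gamma(P;u,v):=\frac{\|Pu\|\,\|Pv\|-\langle Pu,Pv\rangle}{1-\langle u,v\rangle}, $$ with Euclidean norms and inner products, and let $\delta_0:=1-\cos(1/10)$. There exist absolute constants $c_\Gamma,C_\Gamma>0$ (independent of $d$, $n$, $\varepsilon$, $u$, $v$) such that for all integers $0\le d\le n$, every $\varepsilon$ with $0<\varepsilon<\min\{\tfrac18,\tfrac{\delta_0}{8}\}$, and all $u,v\in S^{n-1}$ with $\langle u,v\rangle<1$, $$ \mathbb P\!\left(\Gamma(P;u,v)\ge\frac{d}{2n}\right)\ \ge\ 1-C_\Gamma\,e^{-c_\Gamma\varepsilon^2 d}. $$ -/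

import Mathlib

open MeasureTheory Matrix

noncomputable section

/-- The (product = Borel) sigma-algebra on real matrices. -/
instance matrixMeasurableSpace (m n : ℕ) : MeasurableSpace (Matrix (Fin m) (Fin n) ℝ) :=
  inferInstanceAs (MeasurableSpace (Fin m → Fin n → ℝ))

instance matrixBorelSpace (m n : ℕ) : BorelSpace (Matrix (Fin m) (Fin n) ℝ) :=
  inferInstanceAs (BorelSpace (Fin m → Fin n → ℝ))

instance matrixSecondCountable (m n : ℕ) :
    SecondCountableTopology (Matrix (Fin m) (Fin n) ℝ) :=
  inferInstanceAs (SecondCountableTopology (Fin m → Fin n → ℝ))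

/-- The real orthogonal group `O(n)`. -/
abbrev OrthGroup (n : ℕ) : Type := Matrix.orthogonalGroup (Fin n) ℝ

instance orthGroup_compactSpace (n : ℕ) : CompactSpace (OrthGroup n) := by
  apply isCompact_iff_compactSpace.mp
  have hK : IsCompact (Set.univ.pi fun _ : Fin n => Set.univ.pi fun _ : Fin n =>
      Metric.closedBall (0 : ℝ) 1) :=
    isCompact_univ_pi fun _ => isCompact_univ_pi fun _ => isCompact_closedBall _ _
  refine IsCompact.of_isClosed_subset (X := Matrix (Fin n) (Fin n) ℝ) hK
    (isClosed_unitary (R := Matrix (Fin n) (Fin n) ℝ)) ?_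
  intro Q hQ i _ j _
  simpa using entry_norm_bound_of_unitary (𝕜 := ℝ) hQ i j

/-- The Haar probability measure on the compact group `O(n)`. -/
def orthHaar (n : ℕ) : Measure (OrthGroup n) :=
  Measure.haarMeasure ⊤

/-- The Stiefel manifold of real `d × n` matrices with `P Pᵀ = I_d`. -/
abbrev Stiefel (d n : ℕ) : Type := {P : Matrix (Fin d) (Fin n) ℝ // P * Pᵀ = 1}

/-- The first `d` rows of an orthogonal `n × n` matrix. -/
def firstRows {d n : ℕ} (hdn : d ≤ n) (Q : OrthGroup n) : Stiefel d n :=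
  ⟨Q.1.submatrix (Fin.castLE hdn) id, by
    have hQ : Q.1 * Q.1ᵀ = 1 := (Matrix.mem_orthogonalGroup_iff (Fin n) ℝ).mp Q.2
    ext i j
    have h := congrFun (congrFun hQ (Fin.castLE hdn i)) (Fin.castLE hdn j)
    simpa [Matrix.mul_apply, Matrix.one_apply] using h⟩

theorem measurable_firstRows {d n : ℕ} (hdn : d ≤ n) : Measurable (firstRows hdn) := by
  apply Continuous.measurable
  unfold firstRows
  exact (Continuous.matrix_submatrix continuous_subtype_val _ _).subtype_mk _

/-- The Haar (uniform) probability measure on the Stiefel manifold: the law of the first `d` rows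
of a Haar-distributed orthogonal `n × n` matrix. -/
def stiefelHaar {d n : ℕ} (hdn : d ≤ n) : Measure (Stiefel d n) :=
  (orthHaar n).map (firstRows hdn)

instance orthHaar_isProbabilityMeasure (n : ℕ) : IsProbabilityMeasure (orthHaar n) :=
  ⟨Measure.haarMeasure_self⟩

instance stiefelHaar_isProbabilityMeasure {d n : ℕ} (hdn : d ≤ n) :
    IsProbabilityMeasure (stiefelHaar hdn) :=
  Measure.isProbabilityMeasure_map (measurable_firstRows hdn).aemeasurable

/-- Right multiplication of `P` by an orthogonal matrix `R`. -/
def stiefelMul {d n : ℕ} (P : Stiefel d n) (R : OrthGroup n) : Stiefel d n :=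
  ⟨P.1 * R.1, by
    have hR : R.1 * R.1ᵀ = 1 := (Matrix.mem_orthogonalGroup_iff (Fin n) ℝ).mp R.2
    rw [Matrix.transpose_mul, Matrix.mul_assoc, ← Matrix.mul_assoc R.1, hR, Matrix.one_mul, P.2]⟩

/-- The defining invariance: `stiefelHaar` is invariant under the transitive right action of
`O(n)` on the Stiefel manifold. -/
theorem stiefelHaar_map_mul {d n : ℕ} (hdn : d ≤ n) (R : OrthGroup n) :
    (stiefelHaar hdn).map (fun P => stiefelMul P R) = stiefelHaar hdn := by
  have hm : Measurable (fun P : Stiefel d n => stiefelMul P R) := by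
    apply Continuous.measurable
    exact (continuous_subtype_val.matrix_mul continuous_const).subtype_mk _
  have hR : Measurable (fun Q : OrthGroup n => Q * R) := (continuous_mul_const R).measurable
  have : (orthHaar n).IsHaarMeasure := by unfold orthHaar; infer_instance
  have h1 : (orthHaar n).map (fun Q => Q * R) = orthHaar n := by
    have : IsProbabilityMeasure ((orthHaar n).map (fun Q => Q * R)) :=
      Measure.isProbabilityMeasure_map hR.aemeasurable
    exact Measure.isHaarMeasure_eq_of_isProbabilityMeasure _ _
  unfold stiefelHaar
  rw [Measure.map_map hm (measurable_firstRows hdn)]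
  conv_rhs => rw [← h1, Measure.map_map (measurable_firstRows hdn) hR]
  rfl

/-- The boundary-ball section-efficiency ratio
`Γ(P; u, v) = (‖Pu‖ ‖Pv‖ - ⟨Pu, Pv⟩) / (1 - ⟨u, v⟩)` (Euclidean norms and inner products). -/
def sectionGamma {d n : ℕ} (P : Matrix (Fin d) (Fin n) ℝ) (u v : EuclideanSpace ℝ (Fin n)) : ℝ :=
  (‖Matrix.toEuclideanLin P u‖ * ‖Matrix.toEuclideanLin P v‖
      - inner ℝ (Matrix.toEuclideanLin P u) (Matrix.toEuclideanLin P v))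
    / (1 - inner ℝ u v)

end

/-! With δ = d/n, it suffices to control `P` on four fixed vectors: u + v, u - v, and the sum and
difference of these two rescaled to equal length. If `P` scales their squared norms by δ up to
factors 4/5 and 5/4, polarization makes P(u + v) and P(u - v) nearly orthogonal, and algebra gives Γ
≥ δ/2 (`half_le_sectionGamma`).

For one fixed vector, averaging the Haar rotation against an independent Gaussian vector bounds the
probability of a cone by its Gaussian measure (`orthHaar_orbit_le_stdGaussian`). Distortion then
forces a chi-square variable, with d or n degrees of freedom, to deviate by a relative 1/9, and
Chernoff bounds this by exp(-c d) (`stiefelHaar_distortionSet_le`). A union bound finishes. The rate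
does not involve ε, so the factor ε² ≤ 1 only weakens the estimate. -/

/-! ### Chernoff bounds for chi-square variables -/

open ProbabilityTheory in
theorem integral_exp_mul_sq_gaussianReal {t : ℝ} (ht : t < 1 / 2) :
    ∫ x, Real.exp (t * x ^ 2) ∂(gaussianReal 0 1) = (√(1 - 2 * t))⁻¹ := by
  rw [integral_gaussianReal_eq_integral_smul one_ne_zero]
  have h : ∀ x : ℝ, gaussianPDFReal 0 1 x • Real.exp (t * x ^ 2) =
      (√(2 * Real.pi))⁻¹ * Real.exp (-(1 / 2 - t) * x ^ 2) := fun x => by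
    rw [gaussianPDFReal, smul_eq_mul, mul_assoc, ← Real.exp_add]
    simp only [NNReal.coe_one, mul_one]
    congr 2
    ring
  simp_rw [h]
  rw [integral_const_mul, integral_gaussian, ← Real.sqrt_inv, ← Real.sqrt_inv,
    ← Real.sqrt_mul (by positivity)]
  congr 1
  have h1 : 1 / 2 - t ≠ 0 := by linarith
  have h2 : 1 - 2 * t ≠ 0 := by linarith
  have := Real.pi_ne_zero
  field_simp

section ChiSquare

open ProbabilityTheory

variable {ι : Type*} [Fintype ι]

theorem mgf_sum_sq_pi_gaussianReal (A : Finset ι) {t : ℝ} (ht : t < 1 / 2) :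
    mgf (fun x : ι → ℝ => ∑ i ∈ A, x i ^ 2) (Measure.pi fun _ => gaussianReal 0 1) t =
      (√(1 - 2 * t))⁻¹ ^ A.card := by
  classical
  -- Padding with 1 outside `A` turns the exponential into a product over all coordinates, so that
  -- Fubini applies.
  let f : ι → ℝ → ℝ := fun i y => if i ∈ A then Real.exp (t * y ^ 2) else 1
  have hf : ∀ x : ι → ℝ, Real.exp (t * ∑ i ∈ A, x i ^ 2) = ∏ i, f i (x i) := fun x => by
    rw [Finset.mul_sum, Real.exp_sum, Finset.prod_ite_mem, Finset.univ_inter]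
  have hi : ∀ i, ∫ y, f i y ∂(gaussianReal 0 1) = if i ∈ A then (√(1 - 2 * t))⁻¹ else 1 :=
    fun i => by
      by_cases h : i ∈ A
      · simp [f, h, integral_exp_mul_sq_gaussianReal ht]
      · simp [f, h]
  simp_rw [mgf, hf]
  rw [integral_fintype_prod_eq_prod]
  simp_rw [hi]
  rw [Finset.prod_ite_mem, Finset.univ_inter, Finset.prod_const]

theorem integrable_exp_mul_sum_sq_pi_gaussianReal (A : Finset ι) {t : ℝ} (ht : t < 1 / 2) :
    Integrable (fun x : ι → ℝ => Real.exp (t * ∑ i ∈ A, x i ^ 2))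
      (Measure.pi fun _ => gaussianReal 0 1) := by
  -- A non-integrable function has integral 0 by convention, but this integral is positive.
  refine not_imp_comm.1 integral_undef (ne_of_gt ?_)
  have h : 0 < 1 - 2 * t := by linarith
  have := mgf_sum_sq_pi_gaussianReal A ht
  rw [mgf] at this
  rw [this]
  positivity

/-- The Chernoff rate of the chi-square distribution at relative deviation `η`. -/
noncomputable def chiSquareRate (η : ℝ) : ℝ := (η - Real.log (1 + η)) / 2

theorem chiSquareRate_pos {η : ℝ} (h : -1 < η) (h0 : η ≠ 0) : 0 < chiSquareRate η := by
  have := Real.log_lt_sub_one_of_pos (x := 1 + η) (by linarith) (by simpa using h0)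
  unfold chiSquareRate
  linarith

/-- The parameter t = η / (2(1 + η)) minimizes the Chernoff bound: it solves 1 - 2t = 1 / (1 + η),
and has the sign of η. -/
theorem exp_mul_mgf_eq_exp_neg_chiSquareRate {η : ℝ} (h : -1 < η) (m : ℕ) :
    Real.exp (-(η / (2 * (1 + η))) * ((1 + η) * m)) * (√(1 - 2 * (η / (2 * (1 + η)))))⁻¹ ^ m =
      Real.exp (-(chiSquareRate η * m)) := by
  have h1 : 0 < 1 + η := by linarith
  have h2 : 1 - 2 * (η / (2 * (1 + η))) = (1 + η)⁻¹ := by field_simp; ring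
  rw [h2, Real.sqrt_inv, inv_inv, ← Real.exp_log (Real.sqrt_pos.2 h1), Real.log_sqrt h1.le,
    ← Real.exp_nat_mul, ← Real.exp_add, chiSquareRate]
  congr 1
  field_simp
  ring

theorem chernoff_parameter_lt_half {η : ℝ} (h : -1 < η) : η / (2 * (1 + η)) < 1 / 2 := by
  have h1 : 0 < 1 + η := by linarith
  rw [div_lt_iff₀ (by linarith)]
  linarith

theorem measureReal_sum_sq_ge_le (A : Finset ι) {η : ℝ} (h : 0 ≤ η) :
    (Measure.pi fun _ : ι => gaussianReal 0 1).real {x | (1 + η) * A.card ≤ ∑ i ∈ A, x i ^ 2} ≤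
      Real.exp (-(chiSquareRate η * A.card)) := by
  have ht := chernoff_parameter_lt_half (η := η) (by linarith)
  rw [← exp_mul_mgf_eq_exp_neg_chiSquareRate (by linarith), ← mgf_sum_sq_pi_gaussianReal A ht]
  exact measure_ge_le_exp_mul_mgf _ (by positivity)
    (integrable_exp_mul_sum_sq_pi_gaussianReal A ht)

theorem measureReal_sum_sq_le_le (A : Finset ι) {η : ℝ} (h : -1 < η) (h0 : η ≤ 0) :
    (Measure.pi fun _ : ι => gaussianReal 0 1).real {x | ∑ i ∈ A, x i ^ 2 ≤ (1 + η) * A.card} ≤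
      Real.exp (-(chiSquareRate η * A.card)) := by
  have ht := chernoff_parameter_lt_half h
  rw [← exp_mul_mgf_eq_exp_neg_chiSquareRate h, ← mgf_sum_sq_pi_gaussianReal A ht]
  exact measure_le_le_exp_mul_mgf _ (div_nonpos_of_nonpos_of_nonneg h0 (by linarith))
    (integrable_exp_mul_sum_sq_pi_gaussianReal A ht)

end ChiSquare

/-! ### Comparison of Haar orbits with the Gaussian measure -/

section HaarOrbit

open ProbabilityTheory

variable {n : ℕ}

instance orthGroup_secondCountable (n : ℕ) : SecondCountableTopology (OrthGroup n) :=
  TopologicalSpace.Subtype.secondCountableTopology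
    (Matrix.orthogonalGroup (Fin n) ℝ : Set (Matrix (Fin n) (Fin n) ℝ))

theorem orthHaar_map_mul_right (R : OrthGroup n) :
    (orthHaar n).map (fun Q => Q * R) = orthHaar n := by
  have hR : Measurable (fun Q : OrthGroup n => Q * R) := (continuous_mul_const R).measurable
  have : (orthHaar n).IsHaarMeasure := by unfold orthHaar; infer_instance
  have : IsProbabilityMeasure ((orthHaar n).map (fun Q => Q * R)) :=
    Measure.isProbabilityMeasure_map hR.aemeasurable
  exact Measure.isHaarMeasure_eq_of_isProbabilityMeasure _ _

/-- The linear isometry of Euclidean space given by an orthogonal matrix. -/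
noncomputable def orthIsometry :
    OrthGroup n ≃* (EuclideanSpace ℝ (Fin n) ≃ₗᵢ[ℝ] EuclideanSpace ℝ (Fin n)) :=
  (Unitary.mapEquiv
    { (Matrix.toEuclideanCLM (𝕜 := ℝ) (n := Fin n)).toRingEquiv.toMulEquiv with
      map_star' := map_star (Matrix.toEuclideanCLM (𝕜 := ℝ) (n := Fin n)) }).toMulEquiv.trans
    Unitary.linearIsometryEquiv

theorem orthIsometry_apply (Q : OrthGroup n) (x : EuclideanSpace ℝ (Fin n)) :
    orthIsometry Q x = WithLp.toLp 2 (Q.1 *ᵥ x.ofLp) := rfl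

/-- The reflection in the hyperplane orthogonal to x - y exchanges x and y. -/
theorem exists_orthIsometry_apply_eq {x y : EuclideanSpace ℝ (Fin n)} (h : ‖x‖ = ‖y‖) :
    ∃ R : OrthGroup n, orthIsometry R x = y :=
  ⟨orthIsometry.symm (ℝ ∙ (x - y))ᗮ.reflection, by
    rw [MulEquiv.apply_symm_apply]
    exact Submodule.reflection_sub h⟩

theorem continuous_orthIsometry_apply :
    Continuous fun p : OrthGroup n × EuclideanSpace ℝ (Fin n) => orthIsometry p.1 p.2 := by
  simp_rw [orthIsometry_apply]
  fun_prop

/-- Right translation by an orthogonal matrix taking x to y preserves Haar measure. -/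
theorem orthHaar_orbit_eq {K : Set (EuclideanSpace ℝ (Fin n))} (hK : MeasurableSet K)
    {x y : EuclideanSpace ℝ (Fin n)} (h : ‖x‖ = ‖y‖) :
    orthHaar n {Q | orthIsometry Q x ∈ K} = orthHaar n {Q | orthIsometry Q y ∈ K} := by
  obtain ⟨R, rfl⟩ := exists_orthIsometry_apply_eq h
  have hm : ∀ z, MeasurableSet {Q : OrthGroup n | orthIsometry Q z ∈ K} := fun z =>
    (continuous_orthIsometry_apply.comp (Continuous.prodMk_left z)).measurable hK
  conv_lhs => rw [← orthHaar_map_mul_right R,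
    Measure.map_apply (continuous_mul_const R).measurable (hm x)]
  simp [Set.preimage]

/-- A Haar-rotated unit vector lies in a cone with at most the Gaussian measure of the cone. -/
theorem orthHaar_orbit_le_stdGaussian {K : Set (EuclideanSpace ℝ (Fin n))} (hK : MeasurableSet K)
    (hcone : ∀ x ∈ K, ∀ c : ℝ, c • x ∈ K) {w : EuclideanSpace ℝ (Fin n)} (hw : w ≠ 0) :
    orthHaar n {Q | orthIsometry Q w ∈ K} ≤ stdGaussian (EuclideanSpace ℝ (Fin n)) K := by
  set γ := stdGaussian (EuclideanSpace ℝ (Fin n))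
  -- Rescale w to the length of g; the cone condition includes c = 0, so g = 0 needs no separate
  -- case.
  have hpt : ∀ g : EuclideanSpace ℝ (Fin n),
      orthHaar n {Q | orthIsometry Q w ∈ K} ≤ orthHaar n {Q | orthIsometry Q g ∈ K} := fun g => by
    have hn : ‖w‖ ≠ 0 := norm_ne_zero_iff.2 hw
    have hg : ‖(‖g‖ / ‖w‖) • w‖ = ‖g‖ := by
      rw [norm_smul, norm_div, norm_norm, norm_norm, div_mul_cancel₀ _ hn]
    rw [← orthHaar_orbit_eq hK hg]
    refine measure_mono fun Q hQ => ?_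
    rw [Set.mem_ofPred_eq, map_smul]
    exact hcone _ hQ _
  have hT : MeasurableSet {p : OrthGroup n × EuclideanSpace ℝ (Fin n) |
      orthIsometry p.1 p.2 ∈ K} := continuous_orthIsometry_apply.measurable hK
  calc orthHaar n {Q | orthIsometry Q w ∈ K}
      = ∫⁻ _, orthHaar n {Q | orthIsometry Q w ∈ K} ∂γ := by simp
    _ ≤ ∫⁻ g, orthHaar n {Q | orthIsometry Q g ∈ K} ∂γ := lintegral_mono hpt
    _ = ((orthHaar n).prod γ) {p | orthIsometry p.1 p.2 ∈ K} :=
        (Measure.prod_apply_symm hT).symm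
    _ = ∫⁻ Q, γ (orthIsometry Q ⁻¹' K) ∂(orthHaar n) := Measure.prod_apply hT
    -- Rotation invariance of the Gaussian measure.
    _ = ∫⁻ _, γ K ∂(orthHaar n) := by
        refine lintegral_congr fun Q => ?_
        conv_rhs => rw [show γ = stdGaussian (EuclideanSpace ℝ (Fin n)) from rfl, ← stdGaussian_map (orthIsometry Q),
          Measure.map_apply (orthIsometry Q).continuous.measurable hK]
    _ = γ K := by simp

end HaarOrbit

/-! ### Deterministic lower bound for Γ -/

/-- If `P` distorts squared norms by factors between `4/5` and `5/4` of `δ` along the sum and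
difference of `u` and `v` and the bisectors of these two, then `Γ(P; u, v) ≥ δ / 2`. -/
theorem half_le_sectionGamma {d n : ℕ} (P : Matrix (Fin d) (Fin n) ℝ)
    {u v : EuclideanSpace ℝ (Fin n)} (hu : ‖u‖ = 1) (hv : ‖v‖ = 1) (huv : inner ℝ u v < 1)
    {δ : ℝ} (hδ : 0 ≤ δ)
    (h : ∀ w ∈ ({u + v, u - v, ‖u - v‖ • (u + v) + ‖u + v‖ • (u - v),
        ‖u - v‖ • (u + v) - ‖u + v‖ • (u - v)} : Set (EuclideanSpace ℝ (Fin n))),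
      4 / 5 * δ * ‖w‖ ^ 2 ≤ ‖toEuclideanLin P w‖ ^ 2 ∧
        ‖toEuclideanLin P w‖ ^ 2 ≤ 5 / 4 * δ * ‖w‖ ^ 2) :
    δ / 2 ≤ sectionGamma P u v := by
  have h1 := (h (u + v) (by simp)).1
  have h2 := (h (u - v) (by simp)).1
  have h3 := h (‖u - v‖ • (u + v) + ‖u + v‖ • (u - v)) (by simp)
  have h4 := h (‖u - v‖ • (u + v) - ‖u + v‖ • (u - v)) (by simp)
  clear h
  set s := ‖u + v‖ with hs
  set f := ‖u - v‖ with hf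
  set k : ℝ := inner ℝ u v with hk
  have hs2 : s ^ 2 = 2 + 2 * k := by rw [hs, norm_add_sq_real, hu, hv]; ring
  have hf2 : f ^ 2 = 2 - 2 * k := by rw [hf, norm_sub_sq_real, hu, hv]; ring
  have horth : inner ℝ (u + v) (u - v) = (0 : ℝ) := by
    rw [real_inner_add_sub_eq_zero_iff, hu, hv]
  have hf0 : 0 < f := lt_of_le_of_ne (norm_nonneg _) fun h0 => by nlinarith
  set L := toEuclideanLin P
  set a := ‖L (u + v)‖ ^ 2 with ha
  set c := ‖L (u - v)‖ ^ 2 with hc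
  set b : ℝ := inner ℝ (L (u + v)) (L (u - v)) with hb
  have ha0 : 0 ≤ a := sq_nonneg _
  have hw1 : ‖f • (u + v) + s • (u - v)‖ ^ 2 = 2 * s ^ 2 * f ^ 2 := by
    rw [norm_add_sq_real, norm_smul, norm_smul, inner_smul_left, inner_smul_right, horth, ← hs,
      ← hf, Real.norm_of_nonneg hf0.le, Real.norm_of_nonneg (norm_nonneg _)]
    ring
  have hw2 : ‖f • (u + v) - s • (u - v)‖ ^ 2 = 2 * s ^ 2 * f ^ 2 := by
    rw [norm_sub_sq_real, norm_smul, norm_smul, inner_smul_left, inner_smul_right, horth, ← hs,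
      ← hf, Real.norm_of_nonneg hf0.le, Real.norm_of_nonneg (norm_nonneg _)]
    ring
  have hL1 : ‖L (f • (u + v) + s • (u - v))‖ ^ 2 = f ^ 2 * a + 2 * (f * s * b) + s ^ 2 * c := by
    rw [map_add, map_smul, map_smul, norm_add_sq_real, norm_smul, norm_smul, inner_smul_left,
      inner_smul_right, ← hb, mul_pow, mul_pow, Real.norm_eq_abs, Real.norm_eq_abs, sq_abs, sq_abs]
    simp only [conj_trivial]
    ring
  have hL2 : ‖L (f • (u + v) - s • (u - v))‖ ^ 2 = f ^ 2 * a - 2 * (f * s * b) + s ^ 2 * c := by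
    rw [map_sub, map_smul, map_smul, norm_sub_sq_real, norm_smul, norm_smul, inner_smul_left,
      inner_smul_right, ← hb, mul_pow, mul_pow, Real.norm_eq_abs, Real.norm_eq_abs, sq_abs, sq_abs]
    simp only [conj_trivial]
    ring
  rw [hw1, hL1] at h3
  rw [hw2, hL2] at h4
  -- The two bisector images differ in squared norm by 4fsb, while the bounds allow (5/4 - 4/5) · δ
  -- · 2s²f²; hence 9/40. When s = 0 one cannot divide by fs, but then u + v = 0 and b = 0.
  have hb2 : b ^ 2 ≤ (9 / 40 * δ * s * f) ^ 2 := by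
    rcases (norm_nonneg (u + v)).eq_or_lt with h0 | h0
    · have : b = 0 := by rw [hb, norm_eq_zero.1 h0.symm, map_zero, inner_zero_left]
      rw [this]
      simpa using sq_nonneg (9 / 40 * δ * s * f)
    · have hsf : 0 < f * s := mul_pos hf0 h0
      refine sq_le_sq' (le_of_mul_le_mul_left ?_ hsf) (le_of_mul_le_mul_left ?_ hsf)
      · linarith
      · linarith
  -- Since c ≥ (4/5)δf², the last factor is at least (3/10)δf²; and (9/40)² < (4/5)(3/10).
  have hkey : b ^ 2 ≤ a * (c - δ * f ^ 2 / 2) := by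
    have e1 : 4 / 5 * δ * s ^ 2 * (3 / 10 * δ * f ^ 2) ≤ a * (c - δ * f ^ 2 / 2) := by
      apply mul_le_mul h1 (by linarith) (by positivity) ha0
    have e2 : (0 : ℝ) ≤ (δ * s * f) ^ 2 := sq_nonneg _
    linarith
  have hu' : u = (1 / 2 : ℝ) • ((u + v) + (u - v)) := by module
  have hv' : v = (1 / 2 : ℝ) • ((u + v) - (u - v)) := by module
  have hPu : ‖L u‖ ^ 2 = (a + 2 * b + c) / 4 := by
    conv_lhs => rw [hu', map_smul, map_add, norm_smul, mul_pow, norm_add_sq_real]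
    rw [← ha, ← hb, ← hc]
    norm_num
    ring
  have hPv : ‖L v‖ ^ 2 = (a - 2 * b + c) / 4 := by
    conv_lhs => rw [hv', map_smul, map_sub, norm_smul, mul_pow, norm_sub_sq_real]
    rw [← ha, ← hb, ← hc]
    norm_num
    ring
  have hPuv : inner ℝ (L u) (L v) = (a - c) / 4 := by
    have e1 := norm_add_sq_real (L u) (L v)
    have e2 := norm_sub_sq_real (L u) (L v)
    rw [← map_add] at e1
    rw [← map_sub] at e2
    linarith
  rw [sectionGamma, le_div_iff₀ (by linarith), hPuv, le_sub_iff_add_le]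
  -- After squaring, the claim is 4b² ≤ (a + c)² - (a - c + δf²)². The right side equals 4a(c -
  -- δf²/2) + δf²(2c - δf²), handled by `hkey` and `hF`.
  refine (le_abs_self _).trans (abs_le_of_sq_le_sq ?_ (by positivity))
  have hF : 0 ≤ δ * f ^ 2 * (2 * c - δ * f ^ 2) :=
    mul_nonneg (by positivity) (by linarith [mul_nonneg hδ (sq_nonneg f)])
  have hk' : 1 - k = f ^ 2 / 2 := by linarith
  rw [mul_pow, hPu, hPv, ← hk, hk']
  linarith

/-! ### Concentration of the projected squared norm -/

section Concentration

open ProbabilityTheory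

variable {n : ℕ}

theorem measureReal_stdGaussian_preimage {K : Set (EuclideanSpace ℝ (Fin n))}
    (hK : MeasurableSet K) : (stdGaussian (EuclideanSpace ℝ (Fin n))).real K =
      (Measure.pi fun _ : Fin n => gaussianReal 0 1).real (WithLp.toLp 2 ⁻¹' K) := by
  rw [← map_pi_eq_stdGaussian, map_measureReal_apply (by fun_prop) hK]

/-- The exponential rate in the concentration of `‖Pw‖²` around its mean. -/
noncomputable def projectionRate : ℝ := min (chiSquareRate (1 / 9)) (chiSquareRate (-1 / 9))

theorem projectionRate_pos : 0 < projectionRate :=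
  lt_min (chiSquareRate_pos (by norm_num) (by norm_num))
    (chiSquareRate_pos (by norm_num) (by norm_num))

theorem exp_neg_rate_mul_le {r : ℝ} (hr : projectionRate ≤ r) {d m : ℕ} (h : d ≤ m) :
    Real.exp (-(r * m)) ≤ Real.exp (-(projectionRate * d)) := by
  have hd : (d : ℝ) ≤ m := by exact_mod_cast h
  have := projectionRate_pos.le.trans hr
  gcongr

theorem continuous_coordSumSq (A : Finset (Fin n)) :
    Continuous fun x : EuclideanSpace ℝ (Fin n) => ∑ i ∈ A, x i ^ 2 := by
  fun_prop

/-- A ratio this small forces the partial sum below 8/9 of its mean or the full sum above 10/9 of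
its mean, because (4/5)(10/9) = 8/9. -/
theorem stdGaussian_coordSumSq_le (hn : 0 < n) (A : Finset (Fin n)) :
    (stdGaussian (EuclideanSpace ℝ (Fin n))).real
      {x | ∑ i ∈ A, x i ^ 2 ≤ 4 / 5 * (A.card / n) * ‖x‖ ^ 2} ≤
        2 * Real.exp (-(projectionRate * A.card)) := by
  have hn' : (0 : ℝ) < n := by exact_mod_cast hn
  rw [measureReal_stdGaussian_preimage
    (isClosed_le (continuous_coordSumSq A) (by fun_prop)).measurableSet]
  have h1 := (measureReal_sum_sq_le_le A (η := -1 / 9) (by norm_num) (by norm_num)).trans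
    (exp_neg_rate_mul_le (min_le_right _ _) le_rfl)
  have h2 := (measureReal_sum_sq_ge_le (Finset.univ : Finset (Fin n)) (η := 1 / 9)
    (by norm_num)).trans (exp_neg_rate_mul_le (min_le_left _ _) (Finset.card_le_univ A))
  rw [two_mul]
  refine (measureReal_mono ?_).trans ((measureReal_union_le _ _).trans (add_le_add h1 h2))
  intro x hx
  simp only [Set.mem_preimage, Set.mem_ofPred_eq, EuclideanSpace.real_norm_sq_eq] at hx
  simp only [Set.mem_union, Set.mem_ofPred_eq, Finset.card_univ, Fintype.card_fin]
  by_contra! hc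
  have : 4 / 5 * ((A.card : ℝ) / n) * ∑ i, x i ^ 2 ≤
      4 / 5 * ((A.card : ℝ) / n) * ((1 + 1 / 9) * n) := by
    gcongr
    exact hc.2.le
  have e : 4 / 5 * ((A.card : ℝ) / n) * ((1 + 1 / 9) * n) = (1 + -1 / 9) * A.card := by
    field_simp
    ring
  linarith [hc.1]

/-- The mirror case: (5/4)(8/9) = 10/9. -/
theorem stdGaussian_le_coordSumSq (hn : 0 < n) (A : Finset (Fin n)) :
    (stdGaussian (EuclideanSpace ℝ (Fin n))).real
      {x | 5 / 4 * (A.card / n) * ‖x‖ ^ 2 ≤ ∑ i ∈ A, x i ^ 2} ≤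
        2 * Real.exp (-(projectionRate * A.card)) := by
  have hn' : (0 : ℝ) < n := by exact_mod_cast hn
  rw [measureReal_stdGaussian_preimage
    (isClosed_le (by fun_prop) (continuous_coordSumSq A)).measurableSet]
  have h1 := (measureReal_sum_sq_ge_le A (η := 1 / 9) (by norm_num)).trans
    (exp_neg_rate_mul_le (min_le_left _ _) le_rfl)
  have h2 := (measureReal_sum_sq_le_le (Finset.univ : Finset (Fin n)) (η := -1 / 9)
    (by norm_num) (by norm_num)).trans
      (exp_neg_rate_mul_le (min_le_right _ _) (Finset.card_le_univ A))
  rw [two_mul]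
  refine (measureReal_mono ?_).trans ((measureReal_union_le _ _).trans (add_le_add h1 h2))
  intro x hx
  simp only [Set.mem_preimage, Set.mem_ofPred_eq, EuclideanSpace.real_norm_sq_eq] at hx
  simp only [Set.mem_union, Set.mem_ofPred_eq, Finset.card_univ, Fintype.card_fin]
  by_contra! hc
  have : 5 / 4 * ((A.card : ℝ) / n) * ((1 + -1 / 9) * n) ≤
      5 / 4 * ((A.card : ℝ) / n) * ∑ i, x i ^ 2 := by
    gcongr
    exact hc.2.le
  have e : 5 / 4 * ((A.card : ℝ) / n) * ((1 + -1 / 9) * n) = (1 + 1 / 9) * A.card := by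
    field_simp
    ring
  linarith [hc.1]

theorem orthHaar_real_orbit_le {K : Set (EuclideanSpace ℝ (Fin n))} (hK : MeasurableSet K)
    (hcone : ∀ x ∈ K, ∀ c : ℝ, c • x ∈ K) {w : EuclideanSpace ℝ (Fin n)} (hw : w ≠ 0) :
    (orthHaar n).real {Q | orthIsometry Q w ∈ K} ≤
      (stdGaussian (EuclideanSpace ℝ (Fin n))).real K :=
  ENNReal.toReal_mono (measure_ne_top _ _) (orthHaar_orbit_le_stdGaussian hK hcone hw)

/-- The matrices distorting the squared length of `w` by a factor outside `[4/5, 5/4]` of `d/n`. -/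
def distortionSet (d : ℕ) {n : ℕ} (w : EuclideanSpace ℝ (Fin n)) : Set (Stiefel d n) :=
  {P | ‖toEuclideanLin P.1 w‖ ^ 2 < 4 / 5 * (d / n) * ‖w‖ ^ 2} ∪
    {P | 5 / 4 * (d / n) * ‖w‖ ^ 2 < ‖toEuclideanLin P.1 w‖ ^ 2}

theorem continuous_norm_sq_toEuclideanLin (d : ℕ) (w : EuclideanSpace ℝ (Fin n)) :
    Continuous fun P : Stiefel d n => ‖toEuclideanLin P.1 w‖ ^ 2 := by
  simp_rw [toLpLin_apply]
  fun_prop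

theorem measurableSet_distortionSet (d : ℕ) (w : EuclideanSpace ℝ (Fin n)) :
    MeasurableSet (distortionSet d w) :=
  ((isOpen_lt (continuous_norm_sq_toEuclideanLin d w) continuous_const).union
    (isOpen_lt continuous_const (continuous_norm_sq_toEuclideanLin d w))).measurableSet

theorem norm_sq_toEuclideanLin_firstRows {d : ℕ} (hdn : d ≤ n) (Q : OrthGroup n)
    (w : EuclideanSpace ℝ (Fin n)) :
    ‖toEuclideanLin (firstRows hdn Q).1 w‖ ^ 2 =
      ∑ i ∈ Finset.univ.map (Fin.castLEEmb hdn), (orthIsometry Q w) i ^ 2 := by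
  rw [EuclideanSpace.real_norm_sq_eq, Finset.sum_map]
  rfl

theorem stiefelHaar_distortionSet_le (hn : 0 < n) {d : ℕ} (hdn : d ≤ n)
    (w : EuclideanSpace ℝ (Fin n)) :
    (stiefelHaar hdn).real (distortionSet d w) ≤ 4 * Real.exp (-(projectionRate * d)) := by
  rcases eq_or_ne w 0 with rfl | hw
  -- The inequalities are strict, so the zero vector is never distorted.
  · have : distortionSet d (0 : EuclideanSpace ℝ (Fin n)) = ∅ := by simp [distortionSet]
    rw [this, measureReal_empty]
    positivity
  set A : Finset (Fin n) := Finset.univ.map (Fin.castLEEmb hdn) with hA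
  have hc : A.card = d := by simp [hA]
  have hsmul : ∀ (c : ℝ) (x : EuclideanSpace ℝ (Fin n)),
      ∑ i ∈ A, (c • x) i ^ 2 = c ^ 2 * ∑ i ∈ A, x i ^ 2 := fun c x => by
    simp [mul_pow, Finset.mul_sum]
  have h1 := (orthHaar_real_orbit_le
    (isClosed_le (continuous_coordSumSq A) (by fun_prop)).measurableSet (fun x hx c => by
      simp only [Set.mem_ofPred_eq] at hx ⊢
      rw [hsmul, norm_smul, mul_pow, Real.norm_eq_abs, sq_abs]
      nlinarith [mul_le_mul_of_nonneg_left hx (sq_nonneg c)]) hw).trans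
        (stdGaussian_coordSumSq_le hn A)
  have h2 := (orthHaar_real_orbit_le
    (isClosed_le (by fun_prop) (continuous_coordSumSq A)).measurableSet (fun x hx c => by
      simp only [Set.mem_ofPred_eq] at hx ⊢
      rw [hsmul, norm_smul, mul_pow, Real.norm_eq_abs, sq_abs]
      nlinarith [mul_le_mul_of_nonneg_left hx (sq_nonneg c)]) hw).trans
        (stdGaussian_le_coordSumSq hn A)
  rw [hc] at h1 h2
  rw [stiefelHaar, map_measureReal_apply (measurable_firstRows hdn)
    (measurableSet_distortionSet d w)]
  -- The strict inequalities are relaxed because a cone stable under multiplication by 0 requires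
  -- weak ones.
  have hsub : firstRows hdn ⁻¹' distortionSet d w ⊆
      {Q | orthIsometry Q w ∈ {x : EuclideanSpace ℝ (Fin n) |
        ∑ i ∈ A, x i ^ 2 ≤ 4 / 5 * (d / n) * ‖x‖ ^ 2}} ∪
      {Q | orthIsometry Q w ∈ {x : EuclideanSpace ℝ (Fin n) |
        5 / 4 * (d / n) * ‖x‖ ^ 2 ≤ ∑ i ∈ A, x i ^ 2}} := by
    intro Q hQ
    simp only [distortionSet, Set.mem_preimage, Set.mem_union, Set.mem_ofPred_eq,
      norm_sq_toEuclideanLin_firstRows, LinearIsometryEquiv.norm_map] at hQ ⊢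
    exact hQ.imp le_of_lt le_of_lt
  have := (measureReal_mono (μ := orthHaar n) hsub).trans (measureReal_union_le _ _)
  linarith

end Concentration

/-! ### Union bound and conclusion -/

theorem mainTheorem4 :
    ∃ cΓ CΓ : ℝ, 0 < cΓ ∧ 0 < CΓ ∧
      ∀ (d n : ℕ) (hdn : d ≤ n) (ε : ℝ), 0 < ε →
        ε < min (1 / 8 : ℝ) ((1 - Real.cos (1 / 10)) / 8) →
        ∀ u v : EuclideanSpace ℝ (Fin n), ‖u‖ = 1 → ‖v‖ = 1 → inner ℝ u v < 1 →
          1 - CΓ * Real.exp (-(cΓ * ε ^ 2 * (d : ℝ))) ≤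
            (stiefelHaar hdn).real
              {P : Stiefel d n | (d : ℝ) / (2 * (n : ℝ)) ≤ sectionGamma P.1 u v} := by
  -- 16 = 4 vectors × 2 directions of distortion × 2 chi-square deviations.
  refine ⟨projectionRate, 16, projectionRate_pos, by norm_num, ?_⟩
  intro d n hdn ε hε hε' u v hu hv huv
  -- There are no unit vectors in dimension 0.
  have hn : 0 < n := by
    rcases Nat.eq_zero_or_pos n with rfl | h
    · simp [Subsingleton.elim u 0] at hu
    · exact h
  set w₁ := ‖u - v‖ • (u + v) + ‖u + v‖ • (u - v)
  set w₂ := ‖u - v‖ • (u + v) - ‖u + v‖ • (u - v)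
  set B : Set (Stiefel d n) := distortionSet d (u + v) ∪ distortionSet d (u - v) ∪
    distortionSet d w₁ ∪ distortionSet d w₂ with hB
  have hBm : MeasurableSet B := by
    have := fun w : EuclideanSpace ℝ (Fin n) => measurableSet_distortionSet d w
    exact (((this _).union (this _)).union (this _)).union (this _)
  have hBle : (stiefelHaar hdn).real B ≤ 16 * Real.exp (-(projectionRate * d)) := by
    have h := fun w => stiefelHaar_distortionSet_le hn hdn w
    have e1 := measureReal_union_le (μ := stiefelHaar hdn)
      (distortionSet d (u + v)) (distortionSet d (u - v))
    have e2 := measureReal_union_le (μ := stiefelHaar hdn)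
      (distortionSet d (u + v) ∪ distortionSet d (u - v)) (distortionSet d w₁)
    have e3 := measureReal_union_le (μ := stiefelHaar hdn)
      (distortionSet d (u + v) ∪ distortionSet d (u - v) ∪ distortionSet d w₁)
      (distortionSet d w₂)
    linarith [h (u + v), h (u - v), h w₁, h w₂]
  have hsub : Bᶜ ⊆ {P : Stiefel d n | (d : ℝ) / (2 * (n : ℝ)) ≤ sectionGamma P.1 u v} := by
    intro P hP
    simp only [hB, distortionSet, Set.mem_compl_iff, Set.mem_union, Set.mem_ofPred_eq, not_or,
      not_lt] at hP
    have := half_le_sectionGamma P.1 hu hv huv (δ := d / n) (by positivity) (by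
      rintro w (rfl | rfl | rfl | rfl)
      exacts [hP.1.1.1, hP.1.1.2, hP.1.2, hP.2])
    rwa [div_div, mul_comm] at this
  have hε1 : ε ^ 2 ≤ 1 := by
    have : ε < 1 / 8 := hε'.trans_le (min_le_left _ _)
    nlinarith
  have hexp : Real.exp (-(projectionRate * d)) ≤ Real.exp (-(projectionRate * ε ^ 2 * d)) := by
    have := projectionRate_pos
    gcongr
    exact mul_le_of_le_one_right this.le hε1
  have := measureReal_mono (μ := stiefelHaar hdn) hsub
  rw [probReal_compl_eq_one_sub hBm] at this
  linarith
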